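/- Let $G=(V,E)$ be a finite, connected, undirected simple graph with adjacency matrix ${\bf A}_G$ and maximum degree $\Delta$, and let $\rho(M)$ denote the spectral radius of a square matrix $M$, i.e. the maximum modulus of its eigenvalues; write $\rho_G=\rho({\bf A}_G)$. For $\lambda>0$, the hard-core model on $G$ with fugacity $\lambda$ is the probability distribution $\mu_G$ on $\{\pm1\}^V$ such that $\mu_G(\sigma)\propto\lambda^{|\{v:\sigma(v)=1\}|}$ if $\{v:\sigma(v)=1\}$ is an independent set of $G$, and $\mu_G(\sigma)=0$ otherwise. For $x>1$ let $\lambda_c(x)=\dfrac{x^x}{(x-1)^{x+1}}$. For $\Lambda\subseteq V$ and $\tau\in\{\pm1\}^\Lambda$, the pairwise influence matrix $\mathcal I^{\Lambda,\tau}_G$ is the real matrix indexed by $V\setminus\Lambda$ with entries $$\mathcal I^{\Lambda,\tau}_G(w,u)=\mu_G\big(\sigma(u)=1\mid \sigma|_\Lambda=\tau,\ \sigma(w)=1\big)-\mu_G\big(\sigma(u)=1\mid \sigma|_\Lambda=\tau,\ \sigma(w)=-1\big),$$ where the entry is taken to be $0$ if one of the two events conditioned on has probability zero. **Theorem.** For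 every $\epsilon\in(0,1)$ there is a constant $z\in(0,1)$, depending only on $\epsilon$, such that the following holds. For every finite connected graph $G=(V,E)$ with maximum degree $\Delta\ge2$ and $\rho_G\ge2$, every $\lambda$ with $0<\lambda\le(1-\epsilon)\lambda_c(\rho_G)$, every $\Lambda\subseteq V$ and every $\tau\in\{\pm1\}^\Lambda$, $$\rho\big(\mathcal I^{\Lambda,\tau}_G\big)\le 1+e^3\left(\frac{\Delta}{\rho_G}\right)^{1/2}z^{-1}$$ (the spectral radius of the empty matrix, for $\Lambda=V$, being $0$). -/

import Mathlib

noncomputable section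

namespace HardCore

/-- The spectral radius of a real square matrix: the maximum modulus of its (complex) eigenvalues
(`0` for the empty matrix). -/
def specRadius {n : Type*} [Fintype n] [DecidableEq n] (M : Matrix n n ℝ) : ℝ :=
  (spectralRadius ℂ (M.map (algebraMap ℝ ℂ))).toReal

/-- The supremum in `spectralRadius` is over a finite set, so `toReal` loses nothing. -/
theorem ofReal_specRadius {n : Type*} [Fintype n] [DecidableEq n] (M : Matrix n n ℝ) :
    ENNReal.ofReal (specRadius M) = spectralRadius ℂ (M.map (algebraMap ℝ ℂ)) := by
  refine ENNReal.ofReal_toReal (ne_of_lt ?_)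
  have hfin : (spectrum ℂ (M.map (algebraMap ℝ ℂ))).Finite := Matrix.finite_spectrum _
  obtain ⟨B, hB⟩ := (hfin.image fun k => ‖k‖₊).bddAbove
  refine lt_of_le_of_lt (iSup₂_le fun k hk => ?_) (ENNReal.coe_lt_top (r := B))
  exact_mod_cast hB ⟨k, hk, rfl⟩

/-- The critical fugacity `λ_c(z) = z^z / (z-1)^(z+1)`, for `z > 1`. -/
def criticalFugacity (z : ℝ) : ℝ := z ^ z / (z - 1) ^ (z + 1)

open Classical in
/-- The weight of a configuration with spins `±1`, where `1` is "occupied" and `-1` is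
"unoccupied": `lam ^ (number of occupied vertices)` if the occupied vertices form an independent
set, and `0` otherwise. -/
def weight {V : Type*} [Fintype V] (G : SimpleGraph V) (lam : ℝ) (σ : V → ℤˣ) : ℝ :=
  if G.IsIndepSet {v | σ v = 1} then lam ^ (Finset.univ.filter fun v => σ v = 1).card else 0

open Classical in
/-- The partition function. -/
def partitionFunction {V : Type*} [Fintype V] (G : SimpleGraph V) (lam : ℝ) : ℝ :=
  ∑ σ : V → ℤˣ, weight G lam σ

/-- The Gibbs distribution `μ_G` of the hard-core model on `G` with fugacity `lam`. -/
def gibbs {V : Type*} [Fintype V] (G : SimpleGraph V) (lam : ℝ) (σ : V → ℤˣ) : ℝ :=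
  weight G lam σ / partitionFunction G lam

open Classical in
/-- The probability of a set of configurations under `μ_G`. -/
def prob {V : Type*} [Fintype V] (G : SimpleGraph V) (lam : ℝ) (E : Set (V → ℤˣ)) :
    ℝ :=
  ∑ σ : V → ℤˣ, if σ ∈ E then gibbs G lam σ else 0

/-- The conditional probability `μ_G(E | C)`, meaningful when `μ_G(C) ≠ 0`. -/
def condProb {V : Type*} [Fintype V] (G : SimpleGraph V) (lam : ℝ)
    (E C : Set (V → ℤˣ)) : ℝ :=
  prob G lam (E ∩ C) / prob G lam C

/-- The set of configurations that agree with `τ` on `Λ` and have spin `s` at `w`. -/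
def pinned {V : Type*} (Λ : Finset V) (τ : {v // v ∈ Λ} → ℤˣ) (w : V) (s : ℤˣ) : Set (V → ℤˣ) :=
  {σ | (∀ v : {v // v ∈ Λ}, σ v = τ v) ∧ σ w = s}

open Classical in
/-- The pairwise influence matrix of `μ_G` with respect to the configuration `τ` at `Λ`, indexed
by the vertices outside `Λ`:
`I(w, u) = μ_u(1 | (Λ, τ), (w, 1)) - μ_u(1 | (Λ, τ), (w, -1))`.
When one of the two conditionings is on an event of probability zero, the difference has no
meaning; then `w` cannot take both spins given `τ` and its influence is set to `0`. -/
def influenceMatrix {V : Type*} [Fintype V] (G : SimpleGraph V) (lam : ℝ) (Λ : Finset V)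
    (τ : {v // v ∈ Λ} → ℤˣ) : Matrix {v // v ∉ Λ} {v // v ∉ Λ} ℝ :=
  fun w u =>
    if prob G lam (pinned Λ τ w 1) ≠ 0 ∧ prob G lam (pinned Λ τ w (-1)) ≠ 0 then
      condProb G lam {σ | σ u = 1} (pinned Λ τ w 1)
        - condProb G lam {σ | σ u = 1} (pinned Λ τ w (-1))
    else 0

end HardCore

end

/-! ### Analytic estimates for the tree recursion at criticality -/

namespace HardCore
open Real Finset

/-! Pinning leaves the hard-core model on an induced subgraph (`exists_influenceMatrix_eq`), so it
suffices to bound row sums of `infl` weighted by a positive vector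
(`specRadius_le_of_weighted_row_sum`). The weight is `φ ^ (1 - α)`, with `φ` the Perron vector of
the adjacency matrix and `α = holderExp ρ`.

Deleting the neighbors of `w` one at a time writes the influence of `w` as minus a sum of occupation
probabilities times influences of neighbors in smaller vertex sets (`exists_infl_recursion`). This
replaces an explicit self-avoiding walk tree by induction on the vertex set.

Row sums scaled by the square root of the occupation probability contract: by Hölder's inequality
and `sqrt_mul_rpow_sum_le`, one step costs `η = (1 - ε) ^ (1/4)` times `(ρ⁻¹ ∑ φ v) ^ (1 - α)`, the
sum being over neighbors, and the Perron equation bounds this by `η * φ w ^ (1 - α)`. Summing the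
geometric series gives `sqrt_occ_mul_sum_infl_le`. One unscaled step at the root then costs `Δ ^ α *
ρ ^ (1 - α)` times `λ_c(ρ) ≤ e³ / ρ`, whence `e³ (Δ / ρ) ^ α` with `α ≤ 1/2`. -/

theorem exp_sub_one_div_le {x y : ℝ} (hx : 0 < x) (hxy : x ≤ y) :
    (exp x - 1) / x ≤ (exp y - 1) / y := by
  have hy : 0 < y := hx.trans_le hxy
  have h := convexOn_exp.secant_mono (a := 0) (x := x) (y := y) trivial trivial trivial
    hx.ne' hy.ne' hxy
  simpa using h

/-- The function `log t - θ log (1 - exp (-t))` is minimal where `(exp t - 1) / t = θ`. -/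
theorem log_sub_mul_log_min {t₀ t : ℝ} (h₀ : 0 < t₀) (ht : 0 < t) :
    log t₀ - (exp t₀ - 1) / t₀ * log (1 - exp (-t₀)) ≤
      log t - (exp t₀ - 1) / t₀ * log (1 - exp (-t)) := by
  set θ := (exp t₀ - 1) / t₀ with hθ
  set F : ℝ → ℝ := fun x => log x - θ * log (1 - exp (-x)) with hF
  have hpos : ∀ x : ℝ, 0 < x → 0 < 1 - exp (-x) := fun x hx => by
    have : exp (-x) < 1 := by rw [← exp_zero]; exact exp_lt_exp.2 (by linarith)
    linarith
  -- In this form the sign of the derivative is that of `(exp x - 1) / x - θ`, a secant slope of the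
  -- convex function `exp` minus its value at `t₀`.
  have hd : ∀ x : ℝ, 0 < x → HasDerivAt F ((1 / (exp x - 1)) * ((exp x - 1) / x - θ)) x := by
    intro x hx
    have h1 := (Real.hasDerivAt_log hx.ne')
    have h2 : HasDerivAt (fun y : ℝ => 1 - exp (-y)) (exp (-x)) x := by
      have := ((hasDerivAt_id x).neg.exp).const_sub 1
      simpa using this
    have h3 := (h2.log (hpos x hx).ne').const_mul θ
    have h4 := h1.sub h3
    refine h4.congr_deriv ?_
    have hx1 : exp x - 1 ≠ 0 := by
      have := Real.one_lt_exp_iff.2 hx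
      linarith
    have : exp (-x) / (1 - exp (-x)) = 1 / (exp x - 1) := by
      rw [div_eq_div_iff (hpos x hx).ne' hx1, mul_sub, ← exp_add]
      simp
    rw [this]
    field_simp
  have hsgn : ∀ x : ℝ, 0 < x → 0 < 1 / (exp x - 1) := fun x hx => by
    have := Real.one_lt_exp_iff.2 hx
    exact one_div_pos.2 (by linarith)
  change F t₀ ≤ F t
  rcases le_total t t₀ with h | h
  · have : AntitoneOn F (Set.Icc t t₀) := by
      refine antitoneOn_of_deriv_nonpos (convex_Icc _ _) ?_ ?_ ?_
      · exact fun x hx => (hd x (ht.trans_le hx.1)).continuousAt.continuousWithinAt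
      · rw [interior_Icc]
        exact fun x hx => (hd x (ht.trans hx.1)).differentiableAt.differentiableWithinAt
      · rw [interior_Icc]
        intro x hx
        rw [(hd x (ht.trans hx.1)).deriv]
        have := exp_sub_one_div_le (ht.trans hx.1) hx.2.le
        exact mul_nonpos_of_nonneg_of_nonpos (hsgn x (ht.trans hx.1)).le (by linarith)
    exact this ⟨le_rfl, h⟩ ⟨h, le_rfl⟩ h
  · have : MonotoneOn F (Set.Icc t₀ t) := by
      refine monotoneOn_of_deriv_nonneg (convex_Icc _ _) ?_ ?_ ?_
      · exact fun x hx => (hd x (h₀.trans_le hx.1)).continuousAt.continuousWithinAt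
      · rw [interior_Icc]
        exact fun x hx => (hd x (h₀.trans hx.1)).differentiableAt.differentiableWithinAt
      · rw [interior_Icc]
        intro x hx
        rw [(hd x (h₀.trans hx.1)).deriv]
        have := exp_sub_one_div_le h₀ hx.1.le
        exact mul_nonneg (hsgn x (h₀.trans hx.1)).le (by linarith)
    exact this ⟨le_rfl, h⟩ ⟨h, le_rfl⟩ h

/-- The reciprocal of the exponent conjugate to the one in which the tree recursion of the
hard-core model at fugacity `criticalFugacity k` contracts. -/
noncomputable def holderExp (k : ℝ) : ℝ := (k - 1) * log (k / (k - 1)) / 2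

theorem log_div_sub_one_pos {k : ℝ} (hk : 1 < k) : 0 < log (k / (k - 1)) :=
  log_pos (by rw [lt_div_iff₀ (by linarith)]; linarith)

theorem holderExp_pos {k : ℝ} (hk : 1 < k) : 0 < holderExp k := by
  have := log_div_sub_one_pos hk
  have : 0 < k - 1 := by linarith
  unfold holderExp
  positivity

theorem holderExp_le {k : ℝ} (hk : 1 < k) : holderExp k ≤ 1 / 2 := by
  have h0 : 0 < k - 1 := by linarith
  have h : log (k / (k - 1)) ≤ k / (k - 1) - 1 := log_le_sub_one_of_pos (by positivity)
  have h2 : (k - 1) * (k / (k - 1) - 1) = 1 := by field_simp; ring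
  have := mul_le_mul_of_nonneg_left h h0.le
  unfold holderExp
  linarith

/-- Substitute `t = -log (1 - p)` in `log_sub_mul_log_min`: `holderExp` is chosen so that the
minimum falls at `p = 1 / k`, the occupation probability at the critical fixed point, where equality
holds. -/
theorem rpow_le_neg_log {k p : ℝ} (hk : 1 < k) (hp0 : 0 ≤ p) (hp1 : p < 1) :
    (k * p) ^ ((2 * holderExp k)⁻¹) ≤ -log (1 - p) / log (k / (k - 1)) := by
  have hα := holderExp_pos hk
  have hL := log_div_sub_one_pos hk
  have hk1 : 0 < k - 1 := by linarith
  rcases hp0.eq_or_lt with rfl | hp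
  · rw [mul_zero, zero_rpow (by positivity)]; simp
  have ht : 0 < -log (1 - p) := by
    have := log_neg (show 0 < 1 - p by linarith) (by linarith)
    linarith
  have key := log_sub_mul_log_min hL ht
  rw [neg_neg, exp_neg, exp_log (show 0 < k / (k - 1) by positivity),
    exp_log (show 0 < 1 - p by linarith)] at key
  have e1 : 1 - (k / (k - 1))⁻¹ = k⁻¹ := by field_simp; ring
  have e2 : (k / (k - 1) - 1) / log (k / (k - 1)) = (2 * holderExp k)⁻¹ := by
    unfold holderExp
    field_simp
    ring
  rw [e1, e2, log_inv, sub_sub_cancel] at key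
  rw [← log_le_log_iff (by positivity) (by positivity), log_rpow (by positivity),
    log_mul (by positivity) hp.ne', log_div ht.ne' hL.ne']
  linarith

/-- Weighted AM-GM with weights `1 - 1/k` and `1/k`, tight at the critical fixed point `R = 1 / (k -
1)`. -/
theorem log_one_add_ge {k R : ℝ} (hk : 1 < k) (hR : 0 < R) :
    log k - (1 - k⁻¹) * log (k - 1) + k⁻¹ * log R ≤ log (1 + R) := by
  have hk1 : 0 < k - 1 := by linarith
  have hk0 : 0 < k := by linarith
  have hi : k⁻¹ < 1 := inv_lt_one_of_one_lt₀ hk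
  have h1 := log_le_sub_one_of_pos (show 0 < k / (k - 1) / (1 + R) by positivity)
  have h2 := log_le_sub_one_of_pos (show 0 < k * R / (1 + R) by positivity)
  have h3 := mul_le_mul_of_nonneg_left h1 (show 0 ≤ 1 - k⁻¹ by linarith)
  have h4 := mul_le_mul_of_nonneg_left h2 (show 0 ≤ k⁻¹ by positivity)
  have h5 : (1 - k⁻¹) * (k / (k - 1) / (1 + R) - 1) + k⁻¹ * (k * R / (1 + R) - 1) = 0 := by
    field_simp; ring
  rw [log_div (by positivity) (by positivity), log_div (by positivity) (by positivity)] at h3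
  rw [log_div (by positivity) (by positivity), log_mul (by positivity) (by positivity)] at h4
  linarith

theorem criticalFugacity_pos {k : ℝ} (hk : 1 < k) : 0 < criticalFugacity k := by
  have hk1 : 0 < k - 1 := by linarith
  unfold criticalFugacity
  positivity

theorem log_criticalFugacity {k : ℝ} (hk : 1 < k) :
    log (criticalFugacity k) = k * log k - (k + 1) * log (k - 1) := by
  have hk1 : 0 < k - 1 := by linarith
  unfold criticalFugacity
  rw [log_div (by positivity) (by positivity), log_rpow (by positivity), log_rpow hk1]

/-- The logarithm of `k * criticalFugacity k` is `(k + 1) * log (k / (k - 1)) ≤ (k + 1) / (k - 1)`,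
which is at most `3` from `k = 2` on. -/
theorem criticalFugacity_le {k : ℝ} (hk : 2 ≤ k) : criticalFugacity k ≤ exp 3 / k := by
  have hk1 : 0 < k - 1 := by linarith
  rw [← log_le_log_iff (criticalFugacity_pos (by linarith)) (by positivity),
    log_criticalFugacity (by linarith), log_div (by positivity) (by positivity), log_exp]
  have h : log (k / (k - 1)) ≤ k / (k - 1) - 1 := log_le_sub_one_of_pos (by positivity)
  have h1 : k / (k - 1) - 1 = 1 / (k - 1) := by field_simp; ring
  rw [h1, log_div (by positivity) (by positivity)] at h
  have h2 := mul_le_mul_of_nonneg_left h (show 0 ≤ k + 1 by linarith)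
  have h3 : (k + 1) * (1 / (k - 1)) ≤ 3 := by
    rw [mul_one_div, div_le_iff₀ hk1]; linarith
  linarith

/-- The contraction property of the tree recursion, in the potential with derivative
`√(R / (1 + R))` with respect to `log R`. -/
theorem sqrt_mul_rpow_sum_le {ι : Type*} (B : Finset ι) (p : ι → ℝ) {k ε lam R : ℝ} (hk : 2 ≤ k)
    (hε0 : 0 < ε) (hε1 : ε < 1) (hlam : 0 < lam) (hle : lam ≤ (1 - ε) * criticalFugacity k)
    (hp0 : ∀ v ∈ B, 0 ≤ p v) (hp1 : ∀ v ∈ B, p v < 1) (hR : R = lam * ∏ v ∈ B, (1 - p v)) :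
    √(R / (1 + R)) * (∑ v ∈ B, p v ^ ((2 * holderExp k)⁻¹)) ^ holderExp k ≤
      (1 - ε) ^ (1 / 4 : ℝ) * k⁻¹ ^ (1 - holderExp k) := by
  have hk' : 1 < k := by linarith
  have hk1 : 0 < k - 1 := by linarith
  have hk0 : 0 < k := by linarith
  have hα := holderExp_pos hk'
  have hL := log_div_sub_one_pos hk'
  have hprod : 0 < ∏ v ∈ B, (1 - p v) := prod_pos fun v hv => by linarith [hp1 v hv]
  have hR0 : 0 < R := by rw [hR]; positivity
  have hε : 0 < 1 - ε := by linarith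
  set S := ∑ v ∈ B, p v ^ ((2 * holderExp k)⁻¹) with hS
  have hS0 : 0 ≤ S := sum_nonneg fun v hv => rpow_nonneg (hp0 v hv) _
  rcases hS0.eq_or_lt with h0 | hSpos
  · rw [← h0, zero_rpow hα.ne', mul_zero]
    positivity
  have b1 := log_one_add_ge hk' hR0
  have hRlog : log R = log lam + ∑ v ∈ B, log (1 - p v) := by
    rw [hR, log_mul hlam.ne' hprod.ne', log_prod fun v hv => by linarith [hp1 v hv]]
  have hlamlog : log lam ≤ log (1 - ε) + (k * log k - (k + 1) * log (k - 1)) := by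
    rw [← log_criticalFugacity hk', ← log_mul hε.ne' (criticalFugacity_pos hk').ne']
    exact log_le_log hlam hle
  -- Tangent line of `log` at the value `S` takes for `k` children, each with `p = 1 / k`.
  have b2 : log S ≤ (1 - (2 * holderExp k)⁻¹) * log k + S / k ^ (1 - (2 * holderExp k)⁻¹) - 1 := by
    have := log_le_sub_one_of_pos
      (show 0 < S / k ^ (1 - (2 * holderExp k)⁻¹) by positivity)
    rw [log_div hSpos.ne' (by positivity), log_rpow hk0] at this
    linarith
  have b3 : S / k ^ (1 - (2 * holderExp k)⁻¹) ≤
      k⁻¹ / log (k / (k - 1)) * -∑ v ∈ B, log (1 - p v) := by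
    rw [hS, sum_div, ← sum_neg_distrib, mul_sum]
    refine sum_le_sum fun v hv => ?_
    have := rpow_le_neg_log hk' (hp0 v hv) (hp1 v hv)
    rw [mul_rpow hk0.le (hp0 v hv)] at this
    rw [rpow_sub hk0, rpow_one, div_div_eq_mul_div, div_le_iff₀ hk0]
    calc _ = _ := mul_comm _ _
      _ ≤ _ := this
      _ = _ := by field_simp
  have hαeq : holderExp k = (k - 1) * (log k - log (k - 1)) / 2 := by
    rw [holderExp, log_div hk0.ne' hk1.ne']
  -- This coefficient is opposite to the one that `log R` contributes after `b1`, so the dependence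
  -- on `p` cancels and only `lam` remains.
  have b4 : holderExp k * (k⁻¹ / log (k / (k - 1)) * -∑ v ∈ B, log (1 - p v)) =
      -((1 - k⁻¹) / 2 * ∑ v ∈ B, log (1 - p v)) := by
    unfold holderExp; field_simp
  have b5 : holderExp k * (1 - (2 * holderExp k)⁻¹) = holderExp k - 1 / 2 := by
    field_simp
  have b6 : log (1 - ε) ≤ 0 := log_nonpos hε.le (by linarith)
  have hki : k⁻¹ ≤ 1 / 2 := by
    rw [one_div]; exact inv_anti₀ two_pos hk
  -- The exponent `1 / 4` is the value of `(1 - k⁻¹) / 2` at `k = 2`.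
  have b7 : (1 - k⁻¹) / 2 * log (1 - ε) ≤ 1 / 4 * log (1 - ε) :=
    mul_le_mul_of_nonpos_right (by linarith) b6
  have b8 := mul_le_mul_of_nonneg_left (b2.trans (by linarith [b3] : _ ≤
    (1 - (2 * holderExp k)⁻¹) * log k +
      k⁻¹ / log (k / (k - 1)) * -∑ v ∈ B, log (1 - p v) - 1)) hα.le
  have b9 : holderExp k * ((1 - (2 * holderExp k)⁻¹) * log k +
      k⁻¹ / log (k / (k - 1)) * -∑ v ∈ B, log (1 - p v) - 1) =
      (holderExp k - 1 / 2) * log k - (1 - k⁻¹) / 2 * ∑ v ∈ B, log (1 - p v) - holderExp k := by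
    rw [mul_sub, mul_add, b4, ← mul_assoc, b5]; ring
  rw [b9] at b8
  have b10 := mul_le_mul_of_nonneg_left hlamlog (show 0 ≤ (1 - k⁻¹) / 2 by linarith)
  have b11 : (1 - k⁻¹) / 2 * (log (1 - ε) + (k * log k - (k + 1) * log (k - 1))) =
      (1 - k⁻¹) / 2 * log (1 - ε) + holderExp k + 1 / 2 * log k
        - (1 - k⁻¹) / 2 * log (k - 1) - 1 / 2 * log k := by
    rw [hαeq]; field_simp; ring
  rw [← log_le_log_iff (by positivity) (by positivity), log_mul (by positivity) (by positivity),
    log_mul (by positivity) (by positivity), log_rpow hSpos, log_rpow hε, log_rpow (by positivity),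
    log_sqrt (by positivity), log_div hR0.ne' (by positivity), log_inv]
  rw [hRlog] at b1 ⊢
  linarith

/-- Hölder with exponents `1 / α` and `1 / (1 - α)` separates the `p`-part, handled by
`sqrt_mul_rpow_sum_le`, from the weights. For `m = φ ^ (1 - α)` the right side involves just `∑ φ`.
-/
theorem sqrt_mul_sum_le {ι : Type*} (B : Finset ι) (p m : ι → ℝ) {k ε lam R : ℝ} (hk : 2 ≤ k)
    (hε0 : 0 < ε) (hε1 : ε < 1) (hlam : 0 < lam) (hle : lam ≤ (1 - ε) * criticalFugacity k)
    (hp0 : ∀ v ∈ B, 0 ≤ p v) (hp1 : ∀ v ∈ B, p v < 1) (hR : R = lam * ∏ v ∈ B, (1 - p v))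
    (hm : ∀ v ∈ B, 0 ≤ m v) :
    √(R / (1 + R)) * ∑ v ∈ B, √(p v) * m v ≤
      (1 - ε) ^ (1 / 4 : ℝ) *
        (k⁻¹ * ∑ v ∈ B, m v ^ ((1 - holderExp k)⁻¹)) ^ (1 - holderExp k) := by
  have hk' : 1 < k := by linarith
  have hα := holderExp_pos hk'
  have hα2 := holderExp_le hk'
  have hc : (holderExp k)⁻¹.HolderConjugate (1 - holderExp k)⁻¹ := by
    rw [Real.holderConjugate_iff]
    refine ⟨(one_lt_inv₀ hα).2 (by linarith), by simp⟩
  have h := inner_le_Lp_mul_Lq_of_nonneg B hc (fun v hv => sqrt_nonneg (p v)) hm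
  have e : ∀ v ∈ B, √(p v) ^ (holderExp k)⁻¹ = p v ^ ((2 * holderExp k)⁻¹) := fun v hv => by
    rw [sqrt_eq_rpow, ← rpow_mul (hp0 v hv)]
    congr 1
    field_simp
  rw [sum_congr rfl e, one_div, one_div, inv_inv, inv_inv] at h
  have hT : 0 ≤ ∑ v ∈ B, m v ^ ((1 - holderExp k)⁻¹) :=
    sum_nonneg fun v hv => rpow_nonneg (hm v hv) _
  calc _ ≤ √(R / (1 + R)) * _ := mul_le_mul_of_nonneg_left h (sqrt_nonneg _)
    _ = (√(R / (1 + R)) * (∑ v ∈ B, p v ^ ((2 * holderExp k)⁻¹)) ^ holderExp k) *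
        (∑ v ∈ B, m v ^ ((1 - holderExp k)⁻¹)) ^ (1 - holderExp k) := by ring
    _ ≤ _ := mul_le_mul_of_nonneg_right
      (sqrt_mul_rpow_sum_le B p hk hε0 hε1 hlam hle hp0 hp1 hR) (by positivity)
    _ = _ := by rw [mul_rpow (by positivity) hT]; ring

end HardCore

/-! ### Spectral radius and the Perron vector -/

namespace HardCore
open Finset

theorem specRadius_nonneg {n : Type*} [Fintype n] [DecidableEq n] (M : Matrix n n ℝ) :
    0 ≤ specRadius M := ENNReal.toReal_nonneg

/-- Evaluate the eigenvalue equation at a coordinate where `‖x w‖ / f w` is largest. -/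
theorem specRadius_le_of_weighted_row_sum {n : Type*} [Fintype n] [DecidableEq n]
    (M : Matrix n n ℝ) (f : n → ℝ) (hf : ∀ w, 0 < f w) {b : ℝ} (hb : 0 ≤ b)
    (h : ∀ w, ∑ u, |M w u| * f u ≤ b * f w) : specRadius M ≤ b := by
  refine ENNReal.toReal_le_of_le_ofReal hb (iSup₂_le fun c hc => ?_)
  rw [← enorm_eq_nnnorm, ← ofReal_norm]
  refine ENNReal.ofReal_le_ofReal ?_
  rw [← Matrix.spectrum_toLin', ← Module.End.hasEigenvalue_iff_mem_spectrum] at hc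
  obtain ⟨x, hx⟩ := hc.exists_hasEigenvector
  have hne := hx.2
  have heq : (M.map (algebraMap ℝ ℂ)).mulVec x = c • x := by
    rw [← Matrix.toLin'_apply]; exact hx.apply_eq_smul
  obtain ⟨j, hj⟩ := Function.ne_iff.1 hne
  obtain ⟨w, -, hw⟩ := exists_max_image univ (fun v => ‖x v‖ / f v) ⟨j, mem_univ j⟩
  have hxw : 0 < ‖x w‖ / f w :=
    (div_pos (norm_pos_iff.2 hj) (hf j)).trans_le (hw j (mem_univ j))
  have hxw' : 0 < ‖x w‖ := by
    by_contra h0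
    have : ‖x w‖ = 0 := le_antisymm (not_lt.1 h0) (norm_nonneg _)
    simp [this] at hxw
  have e := congrFun heq w
  simp only [Matrix.mulVec, dotProduct, Matrix.map_apply, Pi.smul_apply, smul_eq_mul] at e
  have : ‖c‖ * ‖x w‖ ≤ b * ‖x w‖ := by
    rw [← norm_mul, ← e]
    calc _ ≤ ∑ u, ‖(algebraMap ℝ ℂ) (M w u) * x u‖ := norm_sum_le _ _
      _ = ∑ u, |M w u| * ‖x u‖ := by simp
      _ ≤ ∑ u, |M w u| * (f u * (‖x w‖ / f w)) := by
        refine sum_le_sum fun u _ => mul_le_mul_of_nonneg_left ?_ (abs_nonneg _)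
        have := (div_le_iff₀ (hf u)).1 (hw u (mem_univ u))
        linarith
      _ = (∑ u, |M w u| * f u) * (‖x w‖ / f w) := by
        rw [sum_mul]; exact sum_congr rfl fun u _ => by ring
      _ ≤ b * f w * (‖x w‖ / f w) := mul_le_mul_of_nonneg_right (h w) hxw.le
      _ = _ := by have := (hf w).ne'; field_simp
  exact le_of_mul_le_mul_right this hxw'

theorem norm_le_specRadius {n : Type*} [Fintype n] [DecidableEq n] (M : Matrix n n ℝ) {c : ℂ}
    (hc : c ∈ spectrum ℂ (M.map (algebraMap ℝ ℂ))) : ‖c‖ ≤ specRadius M := by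
  have h : (‖c‖₊ : ENNReal) ≤ spectralRadius ℂ (M.map (algebraMap ℝ ℂ)) :=
    le_iSup₂ (f := fun k (_ : k ∈ spectrum ℂ (M.map (algebraMap ℝ ℂ))) => (‖k‖₊ : ENNReal)) c hc
  rw [← ofReal_specRadius, ← enorm_eq_nnnorm, ← ofReal_norm] at h
  exact (ENNReal.ofReal_le_ofReal_iff (specRadius_nonneg M)).1 h

theorem exists_norm_eq_specRadius {n : Type*} [Fintype n] [DecidableEq n] [Nonempty n]
    (M : Matrix n n ℝ) : ∃ c ∈ spectrum ℂ (M.map (algebraMap ℝ ℂ)), ‖c‖ = specRadius M := by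
  have hne : (spectrum ℂ (M.map (algebraMap ℝ ℂ))).Nonempty :=
    spectrum.nonempty_of_isAlgClosed_of_finiteDimensional ℂ _
  obtain ⟨c, hc, hmax⟩ := (Matrix.finite_spectrum (M.map (algebraMap ℝ ℂ))).exists_maximalFor
    (fun k => ‖k‖) _ hne
  refine ⟨c, hc, le_antisymm (norm_le_specRadius M hc) ?_⟩
  refine ENNReal.toReal_le_of_le_ofReal (norm_nonneg c) (iSup₂_le fun d hd => ?_)
  rw [← enorm_eq_nnnorm, ← ofReal_norm]
  refine ENNReal.ofReal_le_ofReal ?_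
  rcases le_total ‖d‖ ‖c‖ with h | h
  · exact h
  · exact hmax hd h

theorem mem_spectrum_map {n : Type*} [Fintype n] [DecidableEq n] (M : Matrix n n ℝ) {r : ℝ}
    (hr : r ∈ spectrum ℝ M) : (r : ℂ) ∈ spectrum ℂ (M.map (algebraMap ℝ ℂ)) := by
  rw [Matrix.mem_spectrum_iff_isRoot_charpoly] at hr ⊢
  rw [Matrix.charpoly_map]
  exact hr.map

theorem posSemidef_specRadius_sub {n : Type*} [Fintype n] [DecidableEq n] (M : Matrix n n ℝ)
    (hM : M.IsHermitian) : (specRadius M • (1 : Matrix n n ℝ) - M).PosSemidef := by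
  have hH : (specRadius M • (1 : Matrix n n ℝ) - M).IsHermitian := by
    refine Matrix.IsHermitian.sub ?_ hM
    simp [Matrix.IsHermitian]
  rw [hH.posSemidef_iff_eigenvalues_nonneg]
  intro i
  have hi := hH.eigenvalues_mem_spectrum_real i
  rw [Pi.zero_apply]
  generalize hH.eigenvalues i = t at hi ⊢
  rw [← Algebra.algebraMap_eq_smul_one, ← spectrum.singleton_sub_eq] at hi
  obtain ⟨a, rfl, r, hr, h⟩ := hi
  have := norm_le_specRadius M (mem_spectrum_map M hr)
  rw [Complex.norm_real] at this
  have h2 := (Real.le_norm_self r).trans this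
  rw [← h]
  exact sub_nonneg.2 h2

/-- The Perron vector of a connected graph. -/
theorem exists_perron {V : Type*} [Fintype V] [DecidableEq V] (G : SimpleGraph V)
    [DecidableRel G.Adj] (hG : G.Connected) :
    ∃ φ : V → ℝ, (∀ v, 0 < φ v) ∧
      ∀ v, ∑ u ∈ G.neighborFinset v, φ u = specRadius (G.adjMatrix ℝ) * φ v := by
  have := hG.nonempty
  set ρ := specRadius (G.adjMatrix ℝ)
  obtain ⟨c, hc, hcρ⟩ := exists_norm_eq_specRadius (G.adjMatrix ℝ)
  rw [← Matrix.spectrum_toLin', ← Module.End.hasEigenvalue_iff_mem_spectrum] at hc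
  obtain ⟨x, hx⟩ := hc.exists_hasEigenvector
  have heq : ((G.adjMatrix ℝ).map (algebraMap ℝ ℂ)).mulVec x = c • x := by
    rw [← Matrix.toLin'_apply]; exact hx.apply_eq_smul
  have hmap : (G.adjMatrix ℝ).map (algebraMap ℝ ℂ) = G.adjMatrix ℂ := by
    ext i j; by_cases h : G.Adj i j <;> simp [SimpleGraph.adjMatrix_apply, h]
  rw [hmap] at heq
  -- Moduli of an eigenvector for an eigenvalue of maximal modulus: the triangle inequality gives `ρ
  -- y ≤ A y` entrywise.
  set y : V → ℝ := fun v => ‖x v‖ with hy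
  have hy0 : ∀ v, 0 ≤ y v := fun v => norm_nonneg _
  have hge : ∀ v, ρ * y v ≤ ∑ u ∈ G.neighborFinset v, y u := fun v => by
    have e := congrFun heq v
    rw [SimpleGraph.adjMatrix_mulVec_apply, Pi.smul_apply, smul_eq_mul] at e
    calc ρ * y v = ‖c * x v‖ := by rw [norm_mul, hcρ]
      _ ≤ _ := by rw [← e]; exact norm_sum_le _ _
  have hps := posSemidef_specRadius_sub _ (G.isHermitian_adjMatrix ℝ)
  have hmv : ∀ v, ((specRadius (G.adjMatrix ℝ) • (1 : Matrix V V ℝ) - G.adjMatrix ℝ).mulVec y) v =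
      ρ * y v - ∑ u ∈ G.neighborFinset v, y u := fun v => by
    rw [Matrix.sub_mulVec, Pi.sub_apply, SimpleGraph.adjMatrix_mulVec_apply, Matrix.smul_mulVec,
      Matrix.one_mulVec, Pi.smul_apply, smul_eq_mul]
  -- The quadratic form of `ρ - A` at `y` is at most `0` by `hge`, and a semidefinite form vanishes
  -- only on its kernel.
  have hzero : (specRadius (G.adjMatrix ℝ) • (1 : Matrix V V ℝ) - G.adjMatrix ℝ).mulVec y = 0 := by
    refine (hps.dotProduct_mulVec_zero_iff y).1 (le_antisymm ?_ (hps.dotProduct_mulVec_nonneg y))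
    refine sum_nonpos fun v _ => mul_nonpos_of_nonneg_of_nonpos (by simpa using hy0 v) ?_
    rw [hmv]
    linarith [hge v]
  have heig : ∀ v, ∑ u ∈ G.neighborFinset v, y u = ρ * y v := fun v => by
    have := congrFun hzero v
    rw [hmv, Pi.zero_apply] at this
    linarith
  refine ⟨y, fun v => (hy0 v).lt_of_ne' fun hv => hx.2 ?_, heig⟩
  -- A zero of `y` spreads to all neighbors, hence by connectivity to every vertex, contradicting `x
  -- ≠ 0`.
  have hstep : ∀ a b, G.Adj a b → y a = 0 → y b = 0 := fun a b hab ha => by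
    have := heig a
    rw [ha, mul_zero, sum_eq_zero_iff_of_nonneg fun u _ => hy0 u] at this
    exact this b ((G.mem_neighborFinset a b).2 hab)
  have hall : ∀ a b, G.Reachable a b → y a = 0 → y b = 0 := by
    rintro a b ⟨p⟩
    induction p with
    | nil => exact id
    | cons hadj _ ih => exact fun ha => ih (hstep _ _ hadj ha)
  funext u
  exact norm_eq_zero.1 (hall v u (hG.preconnected v u) hv)

end HardCore

/-! ### Occupation probabilities and the recursion for influences -/

namespace HardCore
open Finset

open Classical in
/-- The sum of `lam ^ |T| * g T` over the independent sets `T ⊆ S`. -/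
noncomputable def indepSum {V : Type*} (G : SimpleGraph V) (lam : ℝ) (S : Finset V)
    (g : Finset V → ℝ) : ℝ :=
  ∑ T ∈ S.powerset.filter fun T : Finset V => G.IsIndepSet (T : Set V), lam ^ T.card * g T

open Classical in
/-- The set `S` without `v` and the neighbors of `v`. -/
noncomputable def remove {V : Type*} (G : SimpleGraph V) (S : Finset V) (v : V) : Finset V :=
  {u ∈ S | u ≠ v ∧ ¬ G.Adj v u}

/-- The partition function of the hard-core model on the subgraph induced on `S`. -/
noncomputable def partSum {V : Type*} (G : SimpleGraph V) (lam : ℝ) (S : Finset V) : ℝ :=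
  indepSum G lam S fun _ => 1

/-- The probability that `u` is occupied in the hard-core model on the subgraph induced on `S`. -/
noncomputable def occ {V : Type*} [DecidableEq V] (G : SimpleGraph V) (lam : ℝ) (S : Finset V) (u : V) :
    ℝ :=
  indepSum G lam S (fun T => if u ∈ T then 1 else 0) / partSum G lam S

section

variable {V : Type*} {G : SimpleGraph V} {lam : ℝ} {S : Finset V}

theorem indepSum_congr {g g' : Finset V → ℝ} (h : ∀ T ⊆ S, g T = g' T) :
    indepSum G lam S g = indepSum G lam S g' := by
  classical
  unfold indepSum
  refine sum_congr rfl fun T hT => ?_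
  rw [h T (mem_powerset.1 (mem_filter.1 hT).1)]

theorem remove_subset (v : V) : remove G S v ⊆ S := by
  classical exact filter_subset _ _

theorem mem_remove {u v : V} : u ∈ remove G S v ↔ u ∈ S ∧ u ≠ v ∧ ¬ G.Adj v u := by
  classical simp [remove]

variable [DecidableEq V]

theorem indepSum_filter_not_mem (v : V) (g : Finset V → ℝ) :
    indepSum G lam S (fun T => if v ∈ T then 0 else g T) = indepSum G lam (S.erase v) g := by
  classical
  unfold indepSum
  have e : ∀ T : Finset V, lam ^ T.card * (if v ∈ T then 0 else g T) =
      if v ∉ T then lam ^ T.card * g T else 0 := fun T => by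
    by_cases h : v ∈ T <;> simp [h]
  rw [sum_congr rfl fun T _ => e T, ← sum_filter, filter_filter]
  refine sum_congr ?_ fun _ _ => rfl
  ext T
  simp only [mem_filter, mem_powerset, subset_erase]
  tauto

theorem indepSum_filter_mem {v : V} (hv : v ∈ S) (g : Finset V → ℝ) :
    indepSum G lam S (fun T => if v ∈ T then g T else 0) =
      lam * indepSum G lam (remove G S v) (fun T => g (insert v T)) := by
  classical
  unfold indepSum
  have e : ∀ T : Finset V, lam ^ T.card * (if v ∈ T then g T else 0) =
      if v ∈ T then lam ^ T.card * g T else 0 := fun T => by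
    by_cases h : v ∈ T <;> simp [h]
  rw [sum_congr rfl fun T _ => e T, ← sum_filter, filter_filter, mul_sum]
  symm
  refine sum_bij' (fun T _ => insert v T) (fun T _ => T.erase v) ?_ ?_ ?_ ?_ ?_
  · intro T hT
    simp only [mem_filter, mem_powerset] at hT ⊢
    refine ⟨insert_subset hv (hT.1.trans (remove_subset v)), ?_, mem_insert_self _ _⟩
    rw [coe_insert]
    intro a ha b hb hab
    rcases ha with rfl | ha <;> rcases hb with rfl | hb
    · exact absurd rfl hab
    · exact (mem_remove.1 (hT.1 hb)).2.2
    · exact fun h => (mem_remove.1 (hT.1 ha)).2.2 h.symm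
    · exact hT.2 ha hb hab
  · intro T hT
    simp only [mem_filter, mem_powerset] at hT ⊢
    refine ⟨fun u hu => ?_, fun a ha b hb hab =>
      hT.2.1 (mem_of_mem_erase ha) (mem_of_mem_erase hb) hab⟩
    have hu' := mem_erase.1 hu
    exact mem_remove.2 ⟨hT.1 hu'.2, hu'.1, hT.2.1 hT.2.2 hu'.2 hu'.1.symm⟩
  · intro T hT
    simp only [mem_filter, mem_powerset] at hT
    exact erase_insert fun h => (mem_remove.1 (hT.1 h)).2.1 rfl
  · intro T hT
    simp only [mem_filter, mem_powerset] at hT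
    exact insert_erase hT.2.2
  · intro T hT
    simp only [mem_filter, mem_powerset] at hT
    rw [card_insert_of_notMem fun h => (mem_remove.1 (hT.1 h)).2.1 rfl]
    ring

theorem indepSum_split {v : V} (hv : v ∈ S) (g : Finset V → ℝ) :
    indepSum G lam S g = indepSum G lam (S.erase v) g +
      lam * indepSum G lam (remove G S v) (fun T => g (insert v T)) := by
  classical
  rw [← indepSum_filter_not_mem, ← indepSum_filter_mem hv]
  unfold indepSum
  rw [← sum_add_distrib]
  refine sum_congr rfl fun T _ => ?_
  by_cases h : v ∈ T <;> simp [h]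

theorem partSum_pos (hlam : 0 < lam) : 0 < partSum G lam S := by
  classical
  unfold partSum indepSum
  refine sum_pos (fun T _ => by positivity) ⟨∅, ?_⟩
  simp [SimpleGraph.IsIndepSet]

theorem occ_nonneg (hlam : 0 < lam) (u : V) : 0 ≤ occ G lam S u := by
  classical
  refine div_nonneg (sum_nonneg fun T _ => ?_) (partSum_pos hlam).le
  positivity

theorem occ_of_notMem {u : V} (hu : u ∉ S) : occ G lam S u = 0 := by
  classical
  have : indepSum G lam S (fun T => if u ∈ T then 1 else 0) = indepSum G lam S fun _ => 0 :=
    indepSum_congr fun T hT => if_neg fun h => hu (hT h)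
  rw [occ, this]
  simp [indepSum]

theorem partSum_split {v : V} (hv : v ∈ S) :
    partSum G lam S = partSum G lam (S.erase v) + lam * partSum G lam (remove G S v) :=
  indepSum_split hv _

theorem occ_self {v : V} (hv : v ∈ S) :
    occ G lam S v = lam * partSum G lam (remove G S v) / partSum G lam S := by
  classical
  unfold occ
  rw [indepSum_filter_mem hv]
  rfl

theorem one_sub_occ_self (hlam : 0 < lam) {v : V} (hv : v ∈ S) :
    1 - occ G lam S v = partSum G lam (S.erase v) / partSum G lam S := by
  have := (partSum_pos (G := G) (S := S) hlam).ne'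
  rw [occ_self hv, eq_div_iff this, sub_mul, div_mul_cancel₀ _ this, partSum_split hv]
  ring

theorem occ_lt_one (hlam : 0 < lam) (v : V) : occ G lam S v < 1 := by
  by_cases hv : v ∈ S
  · have := one_sub_occ_self (G := G) hlam hv
    have h2 : 0 < partSum G lam (S.erase v) / partSum G lam S :=
      div_pos (partSum_pos hlam) (partSum_pos hlam)
    linarith
  · rw [occ_of_notMem hv]; exact one_pos

/-- Law of total probability over the spin of `v`. -/
theorem occ_split (hlam : 0 < lam) {u v : V} (hv : v ∈ S) (huv : u ≠ v) :
    occ G lam S u = (1 - occ G lam S v) * occ G lam (S.erase v) u +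
      occ G lam S v * occ G lam (remove G S v) u := by
  classical
  have h0 := (partSum_pos (G := G) (S := S) hlam).ne'
  have h1 := (partSum_pos (G := G) (S := S.erase v) hlam).ne'
  have h2 := (partSum_pos (G := G) (S := remove G S v) hlam).ne'
  rw [one_sub_occ_self hlam hv, occ_self hv]
  unfold occ
  rw [indepSum_split hv]
  simp only [mem_insert, huv, false_or]
  field_simp

variable (G lam) in
/-- The influence of `w` on `u` in the hard-core model on the subgraph induced on `S`. -/
noncomputable def infl (S : Finset V) (w u : V) : ℝ :=
  if u = w then 1 else occ G lam (remove G S w) u - occ G lam (S.erase w) u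

/-- One step of the telescope. The diagonal value `1` of `infl` makes the identity hold at `u = v`
too. -/
theorem occ_erase_sub (hlam : 0 < lam) {v : V} (hv : v ∈ S) (u : V) :
    occ G lam (S.erase v) u - occ G lam S u = -(occ G lam S v * infl G lam S v u) := by
  unfold infl
  split_ifs with h
  · subst h
    rw [occ_of_notMem (notMem_erase _ _)]
    ring
  · rw [occ_split hlam hv h]
    ring

/-- Removing the vertices of `B` one at a time. -/
theorem exists_telescope (hlam : 0 < lam) (S B : Finset V) (hB : B ⊆ S) :
    ∃ T : V → Finset V, (∀ v ∈ B, T v ⊆ S ∧ v ∈ T v) ∧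
      ∏ v ∈ B, (1 - occ G lam (T v) v) = partSum G lam (S \ B) / partSum G lam S ∧
      ∀ u, occ G lam (S \ B) u - occ G lam S u =
        -∑ v ∈ B, occ G lam (T v) v * infl G lam (T v) v u := by
  induction B using Finset.induction_on with
  | empty =>
    refine ⟨fun _ => ∅, by simp, ?_, by simp⟩
    simp [(partSum_pos (G := G) (S := S) hlam).ne']
  | insert b B hb ih =>
    obtain ⟨T, hT, hprod, hsum⟩ := ih ((subset_insert _ _).trans hB)
    have hbS : b ∈ S \ B := mem_sdiff.2 ⟨hB (mem_insert_self _ _), hb⟩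
    have hset : S \ insert b B = (S \ B).erase b := by
      rw [sdiff_insert]
    have hne : ∀ v ∈ B, v ≠ b := fun v hv h => hb (h ▸ hv)
    -- The set attached to `b` is what is left just before `b` is removed.
    refine ⟨Function.update T b (S \ B), ?_, ?_, fun u => ?_⟩
    · intro v hv
      rcases mem_insert.1 hv with rfl | hv
      · rw [Function.update_self]
        exact ⟨sdiff_subset, hbS⟩
      · rw [Function.update_of_ne (hne v hv)]
        exact hT v hv
    · rw [prod_insert hb, Function.update_self, prod_congr rfl fun v hv => by
        rw [Function.update_of_ne (hne v hv)], hprod, one_sub_occ_self hlam hbS, hset]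
      have := (partSum_pos (G := G) (S := S \ B) hlam).ne'
      field_simp
    · rw [sum_insert hb, Function.update_self, sum_congr rfl fun v hv => by
        rw [Function.update_of_ne (hne v hv)], hset, neg_add, ← hsum, ← occ_erase_sub hlam hbS]
      ring

/-- The recursion for influences along the self-avoiding walks from `w`. -/
theorem exists_infl_recursion (hlam : 0 < lam) {w : V} (hw : w ∈ S) :
    ∃ (B : Finset V) (T : V → Finset V), (∀ v ∈ B, G.Adj w v) ∧
      (∀ v ∈ B, T v ⊆ S.erase w ∧ v ∈ T v) ∧
      occ G lam S w = (lam * ∏ v ∈ B, (1 - occ G lam (T v) v)) /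
        (1 + lam * ∏ v ∈ B, (1 - occ G lam (T v) v)) ∧
      ∀ u, u ≠ w → infl G lam S w u = -∑ v ∈ B, occ G lam (T v) v * infl G lam (T v) v u := by
  classical
  obtain ⟨T, hT, hprod, hsum⟩ := exists_telescope (G := G) hlam (S.erase w)
    {v ∈ S.erase w | G.Adj w v} (filter_subset _ _)
  -- Occupying `w` instead of vacating it amounts to deleting its neighbors, so the telescope
  -- computes both the influence and the occupation ratio of `w`.
  have hset : S.erase w \ {v ∈ S.erase w | G.Adj w v} = remove G S w := by
    ext u
    simp only [mem_sdiff, mem_erase, mem_filter, mem_remove]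
    tauto
  refine ⟨_, T, fun v hv => (mem_filter.1 hv).2, hT, ?_, fun u hu => ?_⟩
  · have h1 := partSum_pos (G := G) (S := S) hlam
    have h2 := (partSum_pos (G := G) (S := S.erase w) hlam).ne'
    rw [hprod, hset, occ_self hw]
    rw [partSum_split hw] at h1 ⊢
    field_simp
  · rw [← hsum, hset, infl, if_neg hu]

end

end HardCore

/-! ### From pinned Gibbs measures to induced subgraphs -/

namespace HardCore
open Finset

section

theorem ite_of_iff_and {p q r : Prop} {_ : Decidable p} {_ : Decidable q} {_ : Decidable r}
    {a : ℝ}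
    (h : r ↔ p ∧ q) : (if r then a else 0) = if p then if q then a else 0 else 0 := by
  by_cases hp : p <;> by_cases hq : q <;> simp [h, hp, hq]

theorem indepSum_zero {V : Type*} {G : SimpleGraph V} {lam : ℝ} {S : Finset V} :
    indepSum G lam S (fun _ => 0) = 0 := by
  simp [indepSum]

variable {V : Type*} [DecidableEq V] {G : SimpleGraph V} {lam : ℝ}

open Classical in
/-- Conditioning on the spins in `Λ` leaves, up to a constant factor, the hard-core model on an
induced subgraph. -/
theorem exists_indepSum_pinned [Fintype V] (hlam : 0 < lam) (t : V → Prop) (Λ : Finset V) :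
    ∃ (c : ℝ) (F : Finset V), 0 ≤ c ∧
      ∀ g : Finset V → ℝ, (∀ T, ∀ v ∈ Λ, g (insert v T) = g T) →
        indepSum G lam univ (fun T => if ∀ v ∈ Λ, (v ∈ T ↔ t v) then g T else 0) =
          c * indepSum G lam F g := by
  induction Λ using Finset.induction_on with
  | empty => exact ⟨1, univ, zero_le_one, fun g _ => by simp⟩
  | insert b Λ hb ih =>
    obtain ⟨c, F, hc, h⟩ := ih
    have key : ∀ g : Finset V → ℝ, (∀ T, ∀ v ∈ insert b Λ, g (insert v T) = g T) →
        indepSum G lam univ (fun T => if ∀ v ∈ insert b Λ, (v ∈ T ↔ t v) then g T else 0) =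
          c * indepSum G lam F (fun T => if b ∈ T ↔ t b then g T else 0) := by
      intro g hg
      rw [← h]
      · refine indepSum_congr fun T _ => ?_
        exact ite_of_iff_and (by rw [forall_mem_insert, and_comm])
      · intro T v hv
        have hvb : b ≠ v := fun e => hb (e ▸ hv)
        simp only [mem_insert, hvb, false_or, hg T v (mem_insert_of_mem hv)]
    by_cases ht : t b
    · by_cases hbF : b ∈ F
      · refine ⟨c * lam, remove G F b, by positivity, fun g hg => ?_⟩
        rw [key g hg]
        simp only [ht, iff_true]
        rw [indepSum_filter_mem hbF, mul_assoc,
          indepSum_congr fun T _ => hg T b (mem_insert_self _ _)]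
      -- Here `b` must be occupied but is no longer available: the pinning is infeasible, recorded
      -- by the factor `0`.
      · refine ⟨0, ∅, le_rfl, fun g hg => ?_⟩
        rw [key g hg]
        simp only [ht, iff_true]
        rw [indepSum_congr (g' := fun _ => 0) fun T hT => if_neg fun hbT => hbF (hT hbT),
          indepSum_zero]
        simp
    · refine ⟨c, F.erase b, hc, fun g hg => ?_⟩
      rw [key g hg]
      simp only [ht, iff_false]
      rw [← indepSum_filter_not_mem, indepSum_congr fun T _ => ite_not _ _ _]

end

section

variable {V : Type*} [Fintype V] [DecidableEq V] {G : SimpleGraph V} {lam : ℝ}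

theorem sum_weight_mul (g : Finset V → ℝ) :
    ∑ σ : V → ℤˣ, weight G lam σ * g {v | σ v = 1} = indepSum G lam univ g := by
  classical
  unfold indepSum
  rw [sum_filter, powerset_univ]
  refine sum_bij' (fun σ _ => univ.filter fun v => σ v = 1)
    (fun T _ v => if v ∈ T then 1 else -1) (by simp) (by simp) ?_ ?_ ?_
  · intro σ _
    funext v
    rcases Int.units_eq_one_or (σ v) with h | h <;> simp [h]
  · intro T _
    ext v
    by_cases h : v ∈ T <;> simp [h]
  · intro σ _
    unfold weight
    have : ((univ.filter fun v => σ v = 1 : Finset V) : Set V) = {v | σ v = 1} := by ext; simp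
    by_cases h : G.IsIndepSet {v | σ v = 1}
    · rw [if_pos h, if_pos (this ▸ h)]
    · rw [if_neg h, if_neg (this ▸ h), zero_mul]

theorem partitionFunction_pos (hlam : 0 < lam) : 0 < partitionFunction G lam := by
  have h := sum_weight_mul (G := G) (lam := lam) fun _ => 1
  simp only [mul_one] at h
  have h2 : partitionFunction G lam = indepSum G lam univ fun _ => 1 := by
    rw [← h]
    unfold partitionFunction
    congr!
  rw [h2]
  exact partSum_pos hlam

theorem prob_eq (E : Set (V → ℤˣ)) (p : Finset V → Prop) [DecidablePred p]
    (h : ∀ σ : V → ℤˣ, σ ∈ E ↔ p (univ.filter fun v => σ v = 1)) :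
    prob G lam E = indepSum G lam univ (fun T => if p T then 1 else 0) /
      partitionFunction G lam := by
  rw [← sum_weight_mul, sum_div]
  unfold prob gibbs
  refine sum_congr (by congr!) fun σ _ => ?_
  have := h σ
  by_cases hE : σ ∈ E
  · have hp := this.1 hE
    rw [if_pos hE, if_pos (by convert hp), mul_one]
  · have hp := fun hp => hE (this.2 hp)
    rw [if_neg hE, if_neg (by convert hp), mul_zero, zero_div]

/-- Each probability in the matrix is the same constant times an independent-set sum over one set
`F`, and the constant cancels in the conditional probabilities. -/
theorem exists_influenceMatrix_eq (hlam : 0 < lam) (Λ : Finset V) (τ : {v // v ∈ Λ} → ℤˣ) :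
    ∃ F : Finset V, ∀ w u, influenceMatrix G lam Λ τ w u =
      if (w : V) ∈ F then infl G lam F w u else 0 := by
  classical
  obtain ⟨c, F, hc, h⟩ := exists_indepSum_pinned (G := G) hlam
    (fun v => ∃ hv : v ∈ Λ, τ ⟨v, hv⟩ = 1) Λ
  have hZ := partitionFunction_pos (G := G) hlam
  have hpin : ∀ σ : V → ℤˣ, (∀ v : {v // v ∈ Λ}, σ v = τ v) ↔
      ∀ v ∈ Λ, (v ∈ (univ.filter fun v => σ v = 1 : Finset V) ↔ ∃ hv : v ∈ Λ, τ ⟨v, hv⟩ = 1) := by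
    intro σ
    rw [Subtype.forall]
    refine forall₂_congr fun v hv => ?_
    simp only [mem_filter, mem_univ, true_and, hv, exists_true_left]
    rcases Int.units_eq_one_or (σ v) with h1 | h1 <;>
      rcases Int.units_eq_one_or (τ ⟨v, hv⟩) with h2 | h2 <;> simp [h1, h2]
  have hp : ∀ (E : Set (V → ℤˣ)) (q : Finset V → Prop) [DecidablePred q],
      (∀ σ : V → ℤˣ, σ ∈ E ↔ (∀ v : {v // v ∈ Λ}, σ v = τ v) ∧ q (univ.filter fun v => σ v = 1)) →
      (∀ T, ∀ v ∈ Λ, (q (insert v T) ↔ q T)) →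
      prob G lam E = c / partitionFunction G lam *
        indepSum G lam F (fun T => if q T then 1 else 0) := by
    intro E q _ hE hq
    rw [prob_eq E (fun T => (∀ v ∈ Λ, (v ∈ T ↔ ∃ hv : v ∈ Λ, τ ⟨v, hv⟩ = 1)) ∧ q T)
      fun σ => by rw [hE, hpin], div_mul_eq_mul_div, ← h]
    · congr 1
      refine indepSum_congr fun T _ => ?_
      exact ite_of_iff_and Iff.rfl
    · intro T v hv
      simp only [hq T v hv]
  have hne : ∀ {x v : V}, x ∉ Λ → v ∈ Λ → x ≠ v := fun hx hv e => hx (e ▸ hv)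
  have hm1 : (-1 : ℤˣ) ≠ 1 := by decide
  have e1 : ∀ w : V, w ∉ Λ → prob G lam (pinned Λ τ w 1) = c / partitionFunction G lam *
      indepSum G lam F (fun T => if w ∈ T then 1 else 0) := fun w hw => by
    refine hp _ (fun T => w ∈ T) (fun σ => ?_) fun T v hv => ?_
    · simp [pinned]
    · simp [hne hw hv]
  have e0 : ∀ w : V, w ∉ Λ → prob G lam (pinned Λ τ w (-1)) = c / partitionFunction G lam *
      indepSum G lam F (fun T => if w ∉ T then 1 else 0) := fun w hw => by
    refine hp _ (fun T => w ∉ T) (fun σ => ?_) fun T v hv => ?_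
    · rcases Int.units_eq_one_or (σ w) with h1 | h1 <;> simp [pinned, h1, hm1, hm1.symm]
    · simp [hne hw hv]
  have e11 : ∀ w u : V, w ∉ Λ → u ∉ Λ → prob G lam ({σ | σ u = 1} ∩ pinned Λ τ w 1) =
      c / partitionFunction G lam *
      indepSum G lam F (fun T => if w ∈ T ∧ u ∈ T then 1 else 0) := fun w u hw hu => by
    refine hp _ (fun T => w ∈ T ∧ u ∈ T) (fun σ => ?_) fun T v hv => ?_
    · simp [pinned]; tauto
    · simp [hne hw hv, hne hu hv]
  have e10 : ∀ w u : V, w ∉ Λ → u ∉ Λ → prob G lam ({σ | σ u = 1} ∩ pinned Λ τ w (-1)) =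
      c / partitionFunction G lam *
      indepSum G lam F (fun T => if w ∉ T ∧ u ∈ T then 1 else 0) := fun w u hw hu => by
    refine hp _ (fun T => w ∉ T ∧ u ∈ T) (fun σ => ?_) fun T v hv => ?_
    · rcases Int.units_eq_one_or (σ w) with h1 | h1 <;>
        simp [pinned, h1, hm1, hm1.symm]; tauto
    · simp [hne hw hv, hne hu hv]
  rcases hc.eq_or_lt with rfl | hc
  -- Infeasible pinning: every conditioning event is null, so the matrix vanishes and `F` may be
  -- empty.
  · refine ⟨∅, fun w u => ?_⟩
    rw [influenceMatrix, e1 w w.2]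
    simp
  refine ⟨F, fun w u => ?_⟩
  unfold influenceMatrix condProb
  rw [e1 w w.2, e0 w w.2, e11 w u w.2 u.2, e10 w u w.2 u.2]
  have hcZ : c / partitionFunction G lam ≠ 0 := (div_pos hc hZ).ne'
  by_cases hw : (w : V) ∈ F
  · have a1 : indepSum G lam F (fun T => if (w : V) ∈ T then 1 else 0) =
        lam * partSum G lam (remove G F w) := indepSum_filter_mem hw _
    have a0 : indepSum G lam F (fun T => if (w : V) ∉ T then 1 else 0) =
        partSum G lam (F.erase w) := by
      rw [partSum, ← indepSum_filter_not_mem, indepSum_congr fun T _ => ite_not _ _ _]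
    have p1 := partSum_pos (G := G) (S := remove G F w) hlam
    have p0 := partSum_pos (G := G) (S := F.erase (w : V)) hlam
    have b1 : indepSum G lam F (fun T => if (w : V) ∈ T ∧ (u : V) ∈ T then 1 else 0) =
        lam * indepSum G lam (remove G F w)
          (fun T => if (u : V) ∈ insert (w : V) T then 1 else 0) := by
      rw [← indepSum_filter_mem hw fun T => if (u : V) ∈ T then 1 else 0]
      exact indepSum_congr fun T _ => ite_and _ _ _ _
    have b0 : indepSum G lam F (fun T => if (w : V) ∉ T ∧ (u : V) ∈ T then 1 else 0) =
        indepSum G lam (F.erase w) (fun T => if (u : V) ∈ T then 1 else 0) := by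
      rw [← indepSum_filter_not_mem]
      refine indepSum_congr fun T _ => ?_
      rw [ite_and, ite_not]
    rw [if_pos hw, a1, a0, b1, b0, if_pos ⟨by positivity, by positivity⟩,
      mul_div_mul_left _ _ hcZ, mul_div_mul_left _ _ hcZ, mul_div_mul_left _ _ hlam.ne']
    change _ - occ G lam (F.erase w) u = _
    unfold infl
    split_ifs with huw
    · rw [huw, occ_of_notMem (notMem_erase _ _)]
      simp only [mem_insert_self, if_true]
      rw [sub_zero]
      exact div_self p1.ne'
    · simp only [mem_insert, huw, false_or]
      rfl
  -- A vertex outside `F` cannot be occupied, so its row takes the default value `0`.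
  · rw [if_neg hw, if_neg]
    rintro ⟨h1, -⟩
    refine h1 ?_
    rw [indepSum_congr (g' := fun _ => 0) fun T hT => if_neg fun hwT => hw (hT hwT),
      indepSum_zero, mul_zero]

end

end HardCore

/-! ### Weighted row sums and the spectral bound -/

namespace HardCore
open Finset Real

section

variable {V : Type*} [Fintype V] [DecidableEq V] {G : SimpleGraph V} {lam : ℝ}

omit [Fintype V] in
theorem occ_le (hlam : 0 < lam) {S : Finset V} {w : V} (hw : w ∈ S) :
    occ G lam S w ≤ lam / (1 + lam) := by
  obtain ⟨B, T, -, -, hocc, -⟩ := exists_infl_recursion (G := G) hlam hw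
  have h0 : 0 ≤ ∏ v ∈ B, (1 - occ G lam (T v) v) :=
    prod_nonneg fun v _ => by linarith [occ_lt_one (G := G) (S := T v) hlam v]
  have h1 : ∏ v ∈ B, (1 - occ G lam (T v) v) ≤ 1 :=
    prod_le_one (fun v _ => by linarith [occ_lt_one (G := G) (S := T v) hlam v])
      fun v _ => by linarith [occ_nonneg (G := G) (S := T v) hlam v]
  rw [hocc, div_le_div_iff₀ (by positivity) (by positivity)]
  nlinarith [mul_le_mul_of_nonneg_left h1 hlam.le]

theorem sum_infl_le (hlam : 0 < lam) {f : V → ℝ} (hf : ∀ v, 0 ≤ f v) {S : Finset V} {w : V}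
    {B : Finset V} {T : V → Finset V}
    (h : ∀ u, u ≠ w → infl G lam S w u = -∑ v ∈ B, occ G lam (T v) v * infl G lam (T v) v u) :
    ∑ u, |infl G lam S w u| * f u ≤
      f w + ∑ v ∈ B, occ G lam (T v) v * ∑ u, |infl G lam (T v) v u| * f u := by
  have hb : ∀ u, |infl G lam S w u| * f u ≤
      (if u = w then f u else 0) + ∑ v ∈ B, occ G lam (T v) v * (|infl G lam (T v) v u| * f u) := by
    intro u
    have hnn : 0 ≤ ∑ v ∈ B, occ G lam (T v) v * (|infl G lam (T v) v u| * f u) :=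
      sum_nonneg fun v _ => mul_nonneg (occ_nonneg hlam v) (mul_nonneg (abs_nonneg _) (hf u))
    by_cases huw : u = w
    · rw [if_pos huw, infl, if_pos huw, abs_one, one_mul]
      linarith
    · rw [if_neg huw, zero_add, h u huw, abs_neg]
      calc _ ≤ (∑ v ∈ B, |occ G lam (T v) v * infl G lam (T v) v u|) * f u :=
            mul_le_mul_of_nonneg_right (abs_sum_le_sum_abs _ _) (hf u)
        _ = _ := by
          rw [sum_mul]
          refine sum_congr rfl fun v _ => ?_
          rw [abs_mul, abs_of_nonneg (occ_nonneg hlam v), mul_assoc]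
  calc _ ≤ _ := sum_le_sum fun u _ => hb u
    _ = _ := by
      rw [sum_add_distrib, sum_ite_eq' univ w f, if_pos (mem_univ w), sum_comm]
      simp only [mul_sum]

variable [DecidableRel G.Adj]

/-- Induction on the size of `S`. Splitting each occupation probability into two square roots gives
one to the inductive bound for the child and leaves the other for the contraction. -/
theorem sqrt_occ_mul_sum_infl_le {k ε : ℝ} (hk : 2 ≤ k) (hε0 : 0 < ε) (hε1 : ε < 1)
    (hlam : 0 < lam) (hle : lam ≤ (1 - ε) * criticalFugacity k) {φ : V → ℝ} (hφ : ∀ v, 0 < φ v)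
    (hA : ∀ v, ∑ u ∈ G.neighborFinset v, φ u ≤ k * φ v) {S : Finset V} {w : V} (hw : w ∈ S) :
    √(occ G lam S w) * ∑ u, |infl G lam S w u| * φ u ^ (1 - holderExp k) ≤
      √(lam / (1 + lam)) / (1 - (1 - ε) ^ (1 / 4 : ℝ)) * φ w ^ (1 - holderExp k) := by
  induction hn : S.card using Nat.strong_induction_on generalizing S w with
  | _ n ih =>
  set η := (1 - ε) ^ (1 / 4 : ℝ) with hη
  have hη1 : η < 1 := rpow_lt_one (by linarith) (by linarith) (by norm_num)
  -- The solution of `C = √(lam / (1 + lam)) + η * C`, the sum of the geometric series.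
  set C := √(lam / (1 + lam)) / (1 - η) with hC
  have hC0 : 0 ≤ C := div_nonneg (sqrt_nonneg _) (by linarith)
  have hk0 : 0 < k := by linarith
  have hα2 := holderExp_le (show 1 < k by linarith)
  have hη0 : 0 ≤ η := rpow_nonneg (by linarith) _
  set f : V → ℝ := fun v => φ v ^ (1 - holderExp k) with hf
  have hf0 : ∀ v, 0 < f v := fun v => rpow_pos_of_pos (hφ v) _
  obtain ⟨B, T, hadj, hT, hocc, hrec⟩ := exists_infl_recursion (G := G) hlam hw
  set X : V → ℝ := fun v => ∑ u, |infl G lam (T v) v u| * f u with hX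
  have h1 := sum_infl_le hlam (fun v => (hf0 v).le) hrec
  have h2 : ∀ v ∈ B, √(occ G lam (T v) v) * X v ≤ C * f v := fun v hv => by
    refine ih (T v).card ?_ (hT v hv).2 rfl
    rw [← hn]
    exact card_lt_card ((hT v hv).1.trans_ssubset (erase_ssubset hw))
  have h3 := sqrt_mul_sum_le B (fun v => occ G lam (T v) v) f hk hε0 hε1 hlam hle
    (fun v _ => occ_nonneg hlam v) (fun v _ => occ_lt_one hlam v) rfl fun v _ => (hf0 v).le
  rw [← hocc] at h3
  have h4 : (k⁻¹ * ∑ v ∈ B, f v ^ ((1 - holderExp k)⁻¹)) ^ (1 - holderExp k) ≤ f w := by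
    have e : ∀ v ∈ B, f v ^ ((1 - holderExp k)⁻¹) = φ v := fun v _ =>
      rpow_rpow_inv (hφ v).le (by linarith)
    rw [sum_congr rfl e]
    refine rpow_le_rpow (mul_nonneg (by positivity) (sum_nonneg fun v _ => (hφ v).le)) ?_
      (by linarith)
    rw [inv_mul_le_iff₀ hk0]
    refine (sum_le_sum_of_subset_of_nonneg (fun v hv => ?_) fun v _ _ => (hφ v).le).trans (hA w)
    exact (G.mem_neighborFinset w v).2 (hadj v hv)
  have h5 : ∑ v ∈ B, occ G lam (T v) v * X v ≤ C * ∑ v ∈ B, √(occ G lam (T v) v) * f v := by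
    rw [mul_sum]
    refine sum_le_sum fun v hv => ?_
    calc _ = √(occ G lam (T v) v) * (√(occ G lam (T v) v) * X v) := by
          rw [← mul_assoc, mul_self_sqrt (occ_nonneg hlam v)]
      _ ≤ √(occ G lam (T v) v) * (C * f v) := mul_le_mul_of_nonneg_left (h2 v hv) (sqrt_nonneg _)
      _ = _ := by ring
  calc √(occ G lam S w) * ∑ u, |infl G lam S w u| * f u
      ≤ √(occ G lam S w) * (f w + C * ∑ v ∈ B, √(occ G lam (T v) v) * f v) :=
        mul_le_mul_of_nonneg_left (h1.trans (by linarith)) (sqrt_nonneg _)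
    _ = √(occ G lam S w) * f w +
        C * (√(occ G lam S w) * ∑ v ∈ B, √(occ G lam (T v) v) * f v) := by ring
    _ ≤ √(lam / (1 + lam)) * f w + C * (η * f w) := by
        refine add_le_add (mul_le_mul_of_nonneg_right (sqrt_le_sqrt (occ_le hlam hw)) (hf0 w).le) ?_
        exact mul_le_mul_of_nonneg_left (h3.trans (mul_le_mul_of_nonneg_left h4 hη0)) hC0
    _ = C * f w := by
        have : 1 - η ≠ 0 := by linarith
        rw [hC]; field_simp; ring

omit [DecidableEq V] in
-- Hölder against the constant `1`; this is the only source of the maximum degree.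
theorem sum_rpow_neighbor_le {k : ℝ} (hk : 2 ≤ k) {φ : V → ℝ} (hφ : ∀ v, 0 < φ v) (w : V)
    (hA : ∑ u ∈ G.neighborFinset w, φ u ≤ k * φ w) :
    ∑ v ∈ G.neighborFinset w, φ v ^ (1 - holderExp k) ≤
      (G.maxDegree : ℝ) ^ holderExp k * k ^ (1 - holderExp k) * φ w ^ (1 - holderExp k) := by
  have hα := holderExp_pos (show 1 < k by linarith)
  have hα2 := holderExp_le (show 1 < k by linarith)
  have hc : (holderExp k)⁻¹.HolderConjugate (1 - holderExp k)⁻¹ := by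
    rw [Real.holderConjugate_iff]
    exact ⟨(one_lt_inv₀ hα).2 (by linarith), by simp⟩
  have h := inner_le_Lp_mul_Lq_of_nonneg (G.neighborFinset w) (f := fun _ => 1) hc
    (fun v _ => zero_le_one) (fun v _ => rpow_nonneg (hφ v).le (1 - holderExp k))
  have e : ∀ v ∈ G.neighborFinset w, (φ v ^ (1 - holderExp k)) ^ ((1 - holderExp k)⁻¹) = φ v :=
    fun v _ => rpow_rpow_inv (hφ v).le (by linarith)
  rw [sum_congr rfl e] at h
  simp only [one_mul, one_rpow, sum_const, nsmul_eq_mul, mul_one, one_div, inv_inv] at h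
  refine h.trans ?_
  rw [mul_assoc, ← mul_rpow (by linarith) (hφ w).le, G.card_neighborFinset_eq_degree]
  refine mul_le_mul (rpow_le_rpow (by positivity) ?_ hα.le) (rpow_le_rpow ?_ hA (by linarith))
    ?_ (by positivity)
  · exact_mod_cast G.degree_le_maxDegree w
  · exact sum_nonneg fun v _ => (hφ v).le
  · exact rpow_nonneg (sum_nonneg fun v _ => (hφ v).le) _

/-- The factor `√occ` at `w` may be arbitrarily small and cannot be divided out. Instead the
recursion is unfolded once, and the scaled bound is applied to the children, whose occupation
probabilities supply the square root. -/
theorem sum_infl_mul_le {k ε : ℝ} (hk : 2 ≤ k) (hε0 : 0 < ε) (hε1 : ε < 1)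
    (hlam : 0 < lam) (hle : lam ≤ (1 - ε) * criticalFugacity k) {φ : V → ℝ} (hφ : ∀ v, 0 < φ v)
    (hA : ∀ v, ∑ u ∈ G.neighborFinset v, φ u ≤ k * φ v) (hkΔ : k ≤ G.maxDegree)
    {S : Finset V} {w : V} (hw : w ∈ S) :
    ∑ u, |infl G lam S w u| * φ u ^ (1 - holderExp k) ≤
      (1 + exp 3 * ((G.maxDegree : ℝ) / k) ^ (1 / 2 : ℝ) * (1 - (1 - ε) ^ (1 / 4 : ℝ))⁻¹) *
        φ w ^ (1 - holderExp k) := by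
  have hk0 : 0 < k := by linarith
  have hΔ : 0 < (G.maxDegree : ℝ) := by linarith
  have hα := holderExp_pos (show 1 < k by linarith)
  have hα2 := holderExp_le (show 1 < k by linarith)
  set η := (1 - ε) ^ (1 / 4 : ℝ) with hη
  have hη1 : 0 < 1 - η := by
    have : η < 1 := rpow_lt_one (by linarith) (by linarith) (by norm_num)
    linarith
  set c := √(lam / (1 + lam)) with hc
  have hc0 : 0 ≤ c := sqrt_nonneg _
  set f : V → ℝ := fun v => φ v ^ (1 - holderExp k) with hf
  have hf0 : ∀ v, 0 < f v := fun v => rpow_pos_of_pos (hφ v) _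
  obtain ⟨B, T, hadj, hT, -, hrec⟩ := exists_infl_recursion (G := G) hlam hw
  have h1 := sum_infl_le hlam (fun v => (hf0 v).le) hrec
  have h2 : ∑ v ∈ B, occ G lam (T v) v * ∑ u, |infl G lam (T v) v u| * f u ≤
      ∑ v ∈ B, c * (c / (1 - η)) * f v := by
    refine sum_le_sum fun v hv => ?_
    have hs := sqrt_occ_mul_sum_infl_le hk hε0 hε1 hlam hle hφ hA (hT v hv).2
    calc _ = √(occ G lam (T v) v) *
          (√(occ G lam (T v) v) * ∑ u, |infl G lam (T v) v u| * f u) := by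
          rw [← mul_assoc, mul_self_sqrt (occ_nonneg hlam v)]
      _ ≤ √(occ G lam (T v) v) * (c / (1 - η) * f v) :=
          mul_le_mul_of_nonneg_left hs (sqrt_nonneg _)
      _ ≤ c * (c / (1 - η) * f v) := mul_le_mul_of_nonneg_right
          (sqrt_le_sqrt (occ_le hlam (hT v hv).2))
          (mul_nonneg (div_nonneg hc0 hη1.le) (hf0 v).le)
      _ = _ := by ring
  have h3 : ∑ v ∈ B, f v ≤
      (G.maxDegree : ℝ) ^ holderExp k * k ^ (1 - holderExp k) * f w := by
    refine (sum_le_sum_of_subset_of_nonneg (fun v hv => ?_) fun v _ _ => (hf0 v).le).trans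
      (sum_rpow_neighbor_le hk hφ w (hA w))
    exact (G.mem_neighborFinset w v).2 (hadj v hv)
  have h4 : c * (c / (1 - η)) ≤ exp 3 / k * (1 - η)⁻¹ := by
    rw [← mul_div_assoc, hc, mul_self_sqrt (by positivity), div_eq_mul_inv]
    refine mul_le_mul_of_nonneg_right ?_ (by positivity)
    have hcf := criticalFugacity_pos (show 1 < k by linarith)
    calc _ ≤ lam := div_le_self hlam.le (by linarith)
      _ ≤ (1 - ε) * criticalFugacity k := hle
      _ ≤ criticalFugacity k := mul_le_of_le_one_left hcf.le (by linarith)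
      _ ≤ _ := criticalFugacity_le hk
  have h5 : k⁻¹ * ((G.maxDegree : ℝ) ^ holderExp k * k ^ (1 - holderExp k)) ≤
      ((G.maxDegree : ℝ) / k) ^ (1 / 2 : ℝ) := by
    calc _ = ((G.maxDegree : ℝ) / k) ^ holderExp k := by
          rw [div_rpow hΔ.le hk0.le, rpow_sub hk0, rpow_one]; field_simp
      -- Since `Δ / k ≥ 1`, the exponent can be raised from `holderExp k` to `1 / 2`.
      _ ≤ _ := rpow_le_rpow_of_exponent_le ((one_le_div hk0).2 hkΔ) hα2
  calc _ ≤ f w + ∑ v ∈ B, c * (c / (1 - η)) * f v := h1.trans (by linarith)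
    _ = f w + c * (c / (1 - η)) * ∑ v ∈ B, f v := by rw [mul_sum]
    _ ≤ f w + exp 3 / k * (1 - η)⁻¹ *
        ((G.maxDegree : ℝ) ^ holderExp k * k ^ (1 - holderExp k) * f w) := by
        refine add_le_add_right (mul_le_mul h4 h3 (sum_nonneg fun v _ => (hf0 v).le) ?_) _
        positivity
    _ = f w + exp 3 * (1 - η)⁻¹ * f w *
        (k⁻¹ * ((G.maxDegree : ℝ) ^ holderExp k * k ^ (1 - holderExp k))) := by ring
    _ ≤ f w + exp 3 * (1 - η)⁻¹ * f w * ((G.maxDegree : ℝ) / k) ^ (1 / 2 : ℝ) := by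
        refine add_le_add_right (mul_le_mul_of_nonneg_left h5 ?_) _
        have := hf0 w
        positivity
    _ = _ := by ring

variable (G) in
theorem specRadius_adjMatrix_le_maxDegree : specRadius (G.adjMatrix ℝ) ≤ G.maxDegree := by
  refine specRadius_le_of_weighted_row_sum _ (fun _ => 1) (fun _ => one_pos) (by positivity)
    fun w => ?_
  have e : ∀ u, |G.adjMatrix ℝ w u| * 1 = G.adjMatrix ℝ w u := fun u => by
    by_cases h : G.Adj w u <;> simp [SimpleGraph.adjMatrix_apply, h]
  rw [sum_congr rfl fun u _ => e u, mul_one]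
  have := G.adjMatrix_mulVec_const_apply (α := ℝ) (a := 1) (v := w)
  simp only [Matrix.mulVec, dotProduct, Function.const_apply, mul_one] at this
  rw [this]
  exact_mod_cast G.degree_le_maxDegree w

theorem specRadius_influenceMatrix_le {ε : ℝ} (hε0 : 0 < ε) (hε1 : ε < 1) (hG : G.Connected)
    (hk : 2 ≤ specRadius (G.adjMatrix ℝ)) (hlam : 0 < lam)
    (hle : lam ≤ (1 - ε) * criticalFugacity (specRadius (G.adjMatrix ℝ)))
    (Λ : Finset V) (τ : {v // v ∈ Λ} → ℤˣ) :
    specRadius (influenceMatrix G lam Λ τ) ≤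
      1 + exp 3 * ((G.maxDegree : ℝ) / specRadius (G.adjMatrix ℝ)) ^ (1 / 2 : ℝ) *
        (1 - (1 - ε) ^ (1 / 4 : ℝ))⁻¹ := by
  obtain ⟨φ, hφ, hA⟩ := exists_perron G hG
  obtain ⟨F, hF⟩ := exists_influenceMatrix_eq (G := G) hlam Λ τ
  have hΔ := specRadius_adjMatrix_le_maxDegree G
  generalize specRadius (G.adjMatrix ℝ) = k at *
  have hη1 : 0 < 1 - (1 - ε) ^ (1 / 4 : ℝ) := by
    have : (1 - ε) ^ (1 / 4 : ℝ) < 1 := rpow_lt_one (by linarith) (by linarith) (by norm_num)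
    linarith
  have hb : 0 ≤ 1 + exp 3 * ((G.maxDegree : ℝ) / k) ^ (1 / 2 : ℝ) *
      (1 - (1 - ε) ^ (1 / 4 : ℝ))⁻¹ := by positivity
  have hf0 : ∀ v, 0 < φ v ^ (1 - holderExp k) := fun v => rpow_pos_of_pos (hφ v) _
  have hrow : ∀ w : {v // v ∉ Λ}, ∑ u : {v // v ∉ Λ},
      |influenceMatrix G lam Λ τ w u| * φ u ^ (1 - holderExp k) ≤
        (1 + exp 3 * ((G.maxDegree : ℝ) / k) ^ (1 / 2 : ℝ) *
          (1 - (1 - ε) ^ (1 / 4 : ℝ))⁻¹) * φ w ^ (1 - holderExp k) := by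
    intro w
    by_cases hw : (w : V) ∈ F
    · refine le_trans ?_ (sum_infl_mul_le hk hε0 hε1 hlam hle hφ (fun v => (hA v).le) hΔ hw)
      simp only [hF, if_pos hw]
      rw [← sum_subtype {v | v ∉ Λ} (by simp)
        fun u => |infl G lam F w u| * φ u ^ (1 - holderExp k)]
      exact sum_le_sum_of_subset_of_nonneg (subset_univ _) fun u _ _ =>
        mul_nonneg (abs_nonneg _) (hf0 u).le
    · simp only [hF, if_neg hw, abs_zero, zero_mul, sum_const_zero]
      exact mul_nonneg hb (hf0 w).le
  exact specRadius_le_of_weighted_row_sum (influenceMatrix G lam Λ τ)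
    (fun v => φ v ^ (1 - holderExp k)) (fun v => hf0 v) hb hrow

end

end HardCore

theorem theorem9p1 (ε : ℝ) (hε0 : 0 < ε) (hε1 : ε < 1) :
    ∃ z : ℝ, 0 < z ∧ z < 1 ∧
      ∀ (V : Type*) [Fintype V] [DecidableEq V] (G : SimpleGraph V) [DecidableRel G.Adj]
        (lam : ℝ),
        G.Connected →
        2 ≤ G.maxDegree →
        2 ≤ HardCore.specRadius (G.adjMatrix ℝ) →
        0 < lam →
        lam ≤ (1 - ε) * HardCore.criticalFugacity (HardCore.specRadius (G.adjMatrix ℝ)) →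
        ∀ (Λ : Finset V) (τ : {v // v ∈ Λ} → ℤˣ),
          HardCore.specRadius (HardCore.influenceMatrix G lam Λ τ) ≤
            1 + Real.exp 3
              * ((G.maxDegree : ℝ) / HardCore.specRadius (G.adjMatrix ℝ)) ^ (1 / 2 : ℝ)
              * z⁻¹ := by
  have hη1 : (1 - ε) ^ (1 / 4 : ℝ) < 1 :=
    Real.rpow_lt_one (by linarith) (by linarith) (by norm_num)
  have hη0 : 0 < (1 - ε) ^ (1 / 4 : ℝ) := Real.rpow_pos_of_pos (by linarith) _
  -- The gap between `1` and the contraction rate.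
  refine ⟨1 - (1 - ε) ^ (1 / 4 : ℝ), by linarith, by linarith, ?_⟩
  intro V _ _ G _ lam hG _ hk hlam hle Λ τ
  exact HardCore.specRadius_influenceMatrix_le hε0 hε1 hG hk hlam hle Λ τ
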